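/- For a real number $\delta>0$, let $\mathbf{Bad}(\delta)$ denote the set of irrational real numbers $x$ for which there exists an integer $Q>0$ (depending on $x$) such that \[\left|x-\frac pq\right|\ \ge\ \frac{\delta}{q^2}\] holds for all integers $q\ge Q$ and all integers $p$ relatively prime to $q$ (where $0$ is relatively prime to $q \geq 1$ only if $q=1$). **Theorem.** Let $N\ge 1$ be an integer, let $r_1,\dots,r_N$ be real numbers, and let $0<\delta<\dfrac{3^{1-N}}{18}$. Then $\bigcap_{i=1}^N\bigl(\mathbf{Bad}(\delta)+r_i\bigr)$ is a dense subset of $\mathbb R$, and, moreover, its Hausdorff dimension satisfies \[\dim_H\left(\bigcap_{i=1}^N\bigl(\mathbf{Bad}(\delta)+r_i\bigr)\right)\ \ge\ \frac{N\,\log\left(\left\lfloor\left(\dfrac{1}{18\,\delta\cdot 3^{N-1}}\right)^{1/N}\right\rfloor\right)}{\log\left(\dfrac{1}{6\delta}\right)},\] where $\mathbf{Bad}(\delta)+r_i=\{x+r_i : x\in\mathbf{Bad}(\delta)\}$. -/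

import Mathlib

/-- The set `Bad(δ)` of `δ`-badly approximable numbers: the irrational reals `x` for which there is
an integer `Q > 0` (depending on `x`) with `|x - p / q| ≥ δ / q ^ 2` for all integers `q ≥ Q` and
all integers `p` relatively prime to `q`. -/
def Bad (δ : ℝ) : Set ℝ :=
  {x : ℝ | Irrational x ∧ ∃ Q : ℤ, 0 < Q ∧
    ∀ q : ℤ, Q ≤ q → ∀ p : ℤ, IsCoprime p q → |x - (p : ℝ) / (q : ℝ)| ≥ δ / (q : ℝ) ^ 2}

/-! Distinct fractions with denominators at most `ℓ ^ (-1/2)` are at least `ℓ` apart, so some third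
of any interval of length `ℓ` stays `ℓ / 6` away from all of them, even after a translation
(`exists_third_avoiding`). Build a Cantor set with level-`k` intervals of length `ℓ_k = ℓ / (3M)^k`:
at level `k` keep the good third for the translate `r (k mod N)` and cut it into `M` pieces, all
kept.

For each `i`, a large `q` meets a level `k ≡ i` mod `N` with `6δ ≤ q² ℓ_k ≤ 1`, because `N` levels
shrink lengths by `(3M)^N ≤ 1/(6δ)`; there the distance to `p/q + r i` is at least `ℓ_k / 6 ≥ δ /
q²` (`exists_param_iInter_bad`). Starting in any interval gives density.

Sending the base-`M` digits of `t ∈ [0, 1)` to the pieces chosen gives a map with Hölder inverse of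
exponent `log M / log (3M)`, a lower bound for the dimension. Since `N log (3M) ≤ log (1/(6δ))`, it
is at least the stated bound. -/

/-- If the points of `C` are `ℓ`-separated, then one of the three thirds of `[a, a + ℓ]` keeps
distance at least `ℓ / 6` from `C`. -/
theorem exists_third_avoiding (C : Set ℝ) (a ℓ : ℝ) (hℓ : 0 < ℓ)
    (hC : ∀ x ∈ C, ∀ y ∈ C, x ≠ y → ℓ ≤ |x - y|) :
    ∃ s : ℤ, 0 ≤ s ∧ s ≤ 2 ∧ ∀ z : ℝ, a + s * (ℓ / 3) ≤ z → z ≤ a + (s + 1) * (ℓ / 3) →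
      ∀ x ∈ C, ℓ / 6 ≤ |z - x| := by
  -- Three bad thirds would give three distinct points of `C` in an interval of length `4ℓ/3 < 2ℓ`.
  by_contra! hcon
  obtain ⟨u, hu1, hu2, x, hx, hux⟩ := hcon 0 le_rfl (by norm_num)
  obtain ⟨v, hv1, hv2, z, hz, hvz⟩ := hcon 1 (by norm_num) (by norm_num)
  obtain ⟨w, hw1, hw2, y, hy, hwy⟩ := hcon 2 (by norm_num) (by norm_num)
  rw [abs_lt] at hux hvz hwy
  push_cast at *
  have hxy : x ≠ y := by rintro rfl; linarith
  have dxy := hC x hx y hy hxy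
  rw [abs_of_nonpos (by linarith)] at dxy
  have hzx : z ≠ x := by rintro rfl; linarith
  have hzy : z ≠ y := by rintro rfl; linarith
  have dzx := hC z hz x hx hzx
  have dzy := hC z hz y hy hzy
  rcases le_abs.1 dzx with h | h <;> rcases le_abs.1 dzy with h' | h' <;> linarith

/-! ### Avoiding translated fractions -/

/-- The fractions whose denominators satisfy `q ^ 2 * ℓ ≤ 1`, translated by `ρ`. -/
def shiftedFractions (ρ ℓ : ℝ) : Set ℝ :=
  {x | ∃ p q : ℤ, 0 < q ∧ (q : ℝ) ^ 2 * ℓ ≤ 1 ∧ x = (p : ℝ) / q + ρ}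

/-- Distinct fractions differ by at least `1 / (q q')`, and `q q' ℓ ≤ (q² + q'²) ℓ / 2 ≤ 1`. -/
theorem shiftedFractions_separated (ρ ℓ : ℝ) (hℓ : 0 < ℓ) :
    ∀ x ∈ shiftedFractions ρ ℓ, ∀ y ∈ shiftedFractions ρ ℓ, x ≠ y → ℓ ≤ |x - y| := by
  rintro x ⟨p, q, hq, hqℓ, rfl⟩ y ⟨p', q', hq', hqℓ', rfl⟩ hne
  have hq0 : (0 : ℝ) < q := by exact_mod_cast hq
  have hq0' : (0 : ℝ) < q' := by exact_mod_cast hq'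
  have hdiff : (p : ℝ) / q + ρ - (p' / q' + ρ) = ((p * q' - q * p' : ℤ) : ℝ) / (q * q') := by
    push_cast
    field_simp
    ring
  have hnum : p * q' - q * p' ≠ 0 := by
    intro h
    rw [h] at hdiff
    apply hne
    simpa [sub_eq_zero] using hdiff
  have h1 : (1 : ℝ) ≤ |((p * q' - q * p' : ℤ) : ℝ)| := by
    exact_mod_cast Int.one_le_abs hnum
  rw [hdiff, abs_div, abs_of_pos (mul_pos hq0 hq0'), le_div_iff₀ (mul_pos hq0 hq0')]
  nlinarith [sq_nonneg ((q : ℝ) - q')]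

/-- A choice of a third (`0`, `1` or `2`) of `[a, a + ℓ]` that keeps distance at least `ℓ / 6` from
the fractions translated by `ρ` with denominators at most `ℓ ^ (-1 / 2)`. -/
noncomputable def goodThird (ρ a ℓ : ℝ) : ℤ :=
  open Classical in
  if hℓ : 0 < ℓ then
    (exists_third_avoiding _ a ℓ hℓ (shiftedFractions_separated ρ ℓ hℓ)).choose
  -- Any default in `{0, 1, 2}` keeps the range bounds unconditional.
  else 0

theorem goodThird_nonneg (ρ a ℓ : ℝ) : 0 ≤ goodThird ρ a ℓ := by
  unfold goodThird
  split_ifs with hℓ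
  · exact (exists_third_avoiding _ a ℓ hℓ (shiftedFractions_separated ρ ℓ hℓ)).choose_spec.1
  · exact le_rfl

theorem goodThird_le_two (ρ a ℓ : ℝ) : goodThird ρ a ℓ ≤ 2 := by
  unfold goodThird
  split_ifs with hℓ
  · exact (exists_third_avoiding _ a ℓ hℓ (shiftedFractions_separated ρ ℓ hℓ)).choose_spec.2.1
  · norm_num

theorem goodThird_avoids {ρ a ℓ : ℝ} (hℓ : 0 < ℓ) {z : ℝ}
    (h1 : a + goodThird ρ a ℓ * (ℓ / 3) ≤ z) (h2 : z ≤ a + (goodThird ρ a ℓ + 1) * (ℓ / 3))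
    {x : ℝ} (hx : x ∈ shiftedFractions ρ ℓ) : ℓ / 6 ≤ |z - x| := by
  unfold goodThird at h1 h2
  rw [dif_pos hℓ] at h1 h2
  exact (exists_third_avoiding _ a ℓ hℓ
    (shiftedFractions_separated ρ ℓ hℓ)).choose_spec.2.2 z h1 h2 x hx

/-! ### The Cantor construction -/

/-- The `k`-th digit of `t` in base `M`. -/
noncomputable def baseDigit (M : ℕ) (t : ℝ) (k : ℕ) : ℤ :=
  ⌊t * (M : ℝ) ^ (k + 1)⌋ - M * ⌊t * (M : ℝ) ^ k⌋

theorem baseDigit_nonneg (M : ℕ) (t : ℝ) (k : ℕ) : 0 ≤ baseDigit M t k := by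
  unfold baseDigit
  rw [sub_nonneg, Int.le_floor]
  push_cast
  rw [pow_succ]
  have h1 := Int.floor_le (t * (M : ℝ) ^ k)
  have h2 : (0 : ℝ) ≤ M := Nat.cast_nonneg M
  nlinarith [mul_le_mul_of_nonneg_left h1 h2]

theorem baseDigit_lt {M : ℕ} (hM : 1 ≤ M) (t : ℝ) (k : ℕ) : baseDigit M t k < M := by
  unfold baseDigit
  rw [sub_lt_iff_lt_add, Int.floor_lt]
  push_cast
  rw [pow_succ]
  have h1 := Int.lt_floor_add_one (t * (M : ℝ) ^ k)
  have h2 : (0 : ℝ) < M := by exact_mod_cast hM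
  nlinarith [mul_lt_mul_of_pos_left h1 h2]

/-- The index, among the `(3 * M) ^ k` subintervals of level `k`, of the subinterval obtained by
choosing at each level `j` the third `s j` and inside it the position given by the `j`-th digit of
`t`. -/
noncomputable def thirdsIndex (M : ℕ) (s : ℕ → ℤ → ℤ) (t : ℝ) : ℕ → ℤ
  | 0 => 0
  | k + 1 => 3 * M * thirdsIndex M s t k + s k (thirdsIndex M s t k) * M + baseDigit M t k

/-- The equality clause feeds the induction: equal indices select the same third, so only the digits
differ. Once the indices differ, a gap `D ≥ 1` grows to `3MD`, and the surplus `2MD` absorbs the at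
most `2M` lost to different thirds. -/
theorem thirdsIndex_sub_ge {M : ℕ} (hM : 1 ≤ M) {s : ℕ → ℤ → ℤ} (hs0 : ∀ k n, 0 ≤ s k n)
    (hs2 : ∀ k n, s k n ≤ 2) {t t' : ℝ} (ht : t ∈ Set.Ico (0 : ℝ) 1)
    (ht' : t' ∈ Set.Ico (0 : ℝ) 1) (htt : t ≤ t') (k : ℕ) :
    ⌊t' * (M : ℝ) ^ k⌋ - ⌊t * (M : ℝ) ^ k⌋ ≤ thirdsIndex M s t' k - thirdsIndex M s t k ∧
    (⌊t' * (M : ℝ) ^ k⌋ = ⌊t * (M : ℝ) ^ k⌋ → thirdsIndex M s t' k = thirdsIndex M s t k) := by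
  have hmono : ∀ j, ⌊t * (M : ℝ) ^ j⌋ ≤ ⌊t' * (M : ℝ) ^ j⌋ := fun j =>
    Int.floor_mono (mul_le_mul_of_nonneg_right htt (by positivity))
  have hM' : (1 : ℤ) ≤ M := by exact_mod_cast hM
  induction k with
  | zero =>
    have h1 : ⌊t⌋ = 0 := Int.floor_eq_zero_iff.2 ht
    have h2 : ⌊t'⌋ = 0 := Int.floor_eq_zero_iff.2 ht'
    simp [h1, h2, thirdsIndex]
  | succ k ih =>
    obtain ⟨ih1, ih2⟩ := ih
    have e : ∀ u : ℝ, ⌊u * (M : ℝ) ^ (k + 1)⌋ = M * ⌊u * (M : ℝ) ^ k⌋ + baseDigit M u k := by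
      intro u; simp [baseDigit]
    have d0 := baseDigit_nonneg M t k
    have d0' := baseDigit_nonneg M t' k
    have d1 := baseDigit_lt hM t k
    have d1' := baseDigit_lt hM t' k
    rw [e, e]
    simp only [thirdsIndex]
    have a0 := hs0 k (thirdsIndex M s t' k)
    have a2 := hs2 k (thirdsIndex M s t k)
    rcases (hmono k).eq_or_lt with h | h
    · rw [ih2 h.symm, h]
      constructor
      · linarith
      · intro h'; linarith
    · constructor
      · have : (0 : ℤ) ≤ M * (thirdsIndex M s t' k - thirdsIndex M s t k -
            (⌊t' * (M : ℝ) ^ k⌋ - ⌊t * (M : ℝ) ^ k⌋)) := mul_nonneg (by linarith) (by linarith)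
        have h3 : (0 : ℤ) ≤ M * (thirdsIndex M s t' k - thirdsIndex M s t k - 1) :=
          mul_nonneg (by linarith) (by linarith)
        nlinarith [mul_nonneg a0 (by linarith : (0 : ℤ) ≤ M),
          mul_nonneg (sub_nonneg.2 a2) (by linarith : (0 : ℤ) ≤ M)]
      · intro h'
        nlinarith [mul_nonneg (by linarith : (0 : ℤ) ≤ ⌊t' * (M : ℝ) ^ k⌋ - ⌊t * (M : ℝ) ^ k⌋ - 1)
          (by linarith : (0 : ℤ) ≤ M)]

/-- The closed intervals are nested, since the offset `s * M + digit` lies between `0` and `3M - 1`.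
-/
theorem exists_mem_thirdsIndex_intervals {M : ℕ} (hM : 1 ≤ M) {s : ℕ → ℤ → ℤ}
    (hs0 : ∀ k n, 0 ≤ s k n) (hs2 : ∀ k n, s k n ≤ 2) (a : ℝ) {ℓ : ℝ} (hℓ : 0 < ℓ) (t : ℝ) :
    ∃ x : ℝ, ∀ k, a + thirdsIndex M s t k * (ℓ / (3 * M) ^ k) ≤ x ∧
      x ≤ a + (thirdsIndex M s t k + 1) * (ℓ / (3 * M) ^ k) := by
  have hM0 : (0 : ℝ) < M := by exact_mod_cast hM
  have hstep : ∀ k : ℕ, ℓ / (3 * (M : ℝ)) ^ k = 3 * M * (ℓ / (3 * M) ^ (k + 1)) := by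
    intro k
    rw [pow_succ]
    field_simp
  have hpos : ∀ k : ℕ, 0 < ℓ / (3 * (M : ℝ)) ^ k := fun k => by positivity
  have hd0 : ∀ k, (0 : ℝ) ≤ baseDigit M t k := fun k => by exact_mod_cast baseDigit_nonneg M t k
  have hd1 : ∀ k, (baseDigit M t k : ℝ) + 1 ≤ M := fun k => by
    exact_mod_cast baseDigit_lt hM t k
  have hlo : Monotone fun k => a + thirdsIndex M s t k * (ℓ / (3 * (M : ℝ)) ^ k) := by
    refine monotone_nat_of_le_succ fun k => ?_
    have h0 : (0 : ℝ) ≤ s k (thirdsIndex M s t k) := by exact_mod_cast hs0 _ _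
    rw [hstep k]
    simp only [thirdsIndex]
    push_cast
    have := mul_nonneg (add_nonneg (mul_nonneg h0 hM0.le) (hd0 k)) (hpos (k + 1)).le
    linarith
  have hhi : Antitone fun k => a + (thirdsIndex M s t k + 1) * (ℓ / (3 * (M : ℝ)) ^ k) := by
    refine antitone_nat_of_succ_le fun k => ?_
    have h2 : (s k (thirdsIndex M s t k) : ℝ) ≤ 2 := by exact_mod_cast hs2 _ _
    rw [hstep k]
    simp only [thirdsIndex]
    push_cast
    have h3 : (s k (thirdsIndex M s t k) : ℝ) * M ≤ 2 * M := by gcongr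
    have := mul_nonneg (by linarith [hd1 k] : (0 : ℝ) ≤ 3 * M -
      (s k (thirdsIndex M s t k) * M + baseDigit M t k + 1)) (hpos (k + 1)).le
    linarith
  have hle : ∀ k, a + thirdsIndex M s t k * (ℓ / (3 * (M : ℝ)) ^ k) ≤
      a + (thirdsIndex M s t k + 1) * (ℓ / (3 * (M : ℝ)) ^ k) := fun k => by
    linarith [hpos k]
  have := Monotone.ciSup_mem_iInter_Icc_of_antitone hlo hhi hle
  exact ⟨_, fun k => Set.mem_iInter.1 this k⟩

/-! ### Points of the Cantor set are badly approximable -/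

/-- A real number all of whose translates `x - r i` satisfy `|x - r i - p / q| ≥ δ / q ^ 2` for
large `q` and all `p`, whether or not `p / q` is reduced, lies in all the `Bad δ + r i`. -/
theorem mem_iInter_image_bad {N : ℕ} {r : Fin N → ℝ} {δ x : ℝ} (hδ : 0 < δ) {Q : ℤ} (hQ : 0 < Q)
    (h : ∀ i, ∀ q : ℤ, Q ≤ q → ∀ p : ℤ, δ / (q : ℝ) ^ 2 ≤ |x - (p / q + r i)|) :
    x ∈ ⋂ i : Fin N, (fun x : ℝ => x + r i) '' Bad δ := by
  refine Set.mem_iInter.2 fun i => ⟨x - r i, ⟨?_, Q, hQ, ?_⟩, by simp⟩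
  · rintro ⟨c, hc⟩
    have hd : (0 : ℝ) < c.den := by exact_mod_cast c.den_pos
    have hQ' : (0 : ℝ) < Q := by exact_mod_cast hQ
    -- A rational `c` is excluded by its unreduced form, scaled by `Q` to make the denominator
    -- large.
    have hle : Q ≤ Q * c.den := le_mul_of_one_le_right hQ.le (by exact_mod_cast c.den_pos)
    have h1 := h i (Q * c.den) hle (Q * c.num)
    have h2 : x - (((Q * c.num : ℤ) : ℝ) / ((Q * c.den : ℤ) : ℝ) + r i) = 0 := by
      rw [Rat.cast_def] at hc
      push_cast
      rw [mul_div_mul_left _ _ hQ'.ne']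
      linarith
    rw [h2, abs_zero] at h1
    have : 0 < δ / (((Q * c.den : ℤ) : ℝ)) ^ 2 := by push_cast; positivity
    linarith
  · intro q hq p _
    have := h i q hq p
    rwa [show x - r i - (p : ℝ) / q = x - (p / q + r i) by ring]

/-- For every large `q` and every residue `i` modulo `N` there is a level `k` of that residue whose
scale matches `q`. -/
theorem exists_level {N : ℕ} {b ε ℓ q : ℝ} (hb : 1 < b) (hε : ε * b ^ N ≤ 1)
    (hℓ : 0 < ℓ) {i : ℕ} (hi : i < N) (hq : b ^ N < q ^ 2 * ℓ) :
    ∃ k : ℕ, k % N = i ∧ q ^ 2 * (ℓ / b ^ k) ≤ 1 ∧ ε ≤ q ^ 2 * (ℓ / b ^ k) := by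
  have hb0 : 0 < b := by linarith
  have hex : ∃ m : ℕ, q ^ 2 * (ℓ / b ^ (i + N * m)) ≤ 1 := by
    obtain ⟨n, hn⟩ := pow_unbounded_of_one_lt (q ^ 2 * ℓ) hb
    refine ⟨n, ?_⟩
    rw [← mul_div_assoc, div_le_one (by positivity)]
    refine hn.le.trans (pow_le_pow_right₀ hb.le ?_)
    nlinarith
  -- Take the least such `m`: it is not `0` by `hq`, and the previous level of this residue, longer
  -- by `b ^ N`, has value above `1`.
  classical
  have hspec := Nat.find_spec hex
  have hmin := fun m => Nat.find_min (m := m) hex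
  generalize Nat.find hex = m at hspec hmin
  refine ⟨i + N * m, by rw [Nat.add_mul_mod_self_left, Nat.mod_eq_of_lt hi], hspec, ?_⟩
  cases m with
  | zero =>
    rw [← mul_div_assoc, div_le_one (by positivity)] at hspec
    have : b ^ (i + N * 0) ≤ b ^ N := pow_le_pow_right₀ hb.le (by omega)
    linarith
  | succ m =>
    have h1 := hmin m (Nat.lt_succ_self m)
    rw [not_le] at h1
    have h2 : q ^ 2 * (ℓ / b ^ (i + N * m)) = q ^ 2 * (ℓ / b ^ (i + N * (m + 1))) * b ^ N := by
      rw [show i + N * (m + 1) = i + N * m + N by ring, pow_add _ (i + N * m)]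
      field_simp
    rw [h2] at h1
    exact le_of_mul_le_mul_right (hε.trans h1.le) (by positivity)

/-- Every interval `[a, a + ℓ]` contains a family of points of the intersection, indexed by
`t ∈ [0, 1)`, whose distances control those of the base-`M` expansions of the parameters. -/
theorem exists_param_iInter_bad {N : ℕ} (hN : 1 ≤ N) (r : Fin N → ℝ) {δ : ℝ} (hδ : 0 < δ) {M : ℕ}
    (hM : 1 ≤ M) (hMδ : 6 * δ * (3 * (M : ℝ)) ^ N ≤ 1) (a : ℝ) {ℓ : ℝ} (hℓ : 0 < ℓ) :
    ∃ g : ℝ → ℝ,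
      (∀ t, g t ∈ ⋂ i : Fin N, (fun x : ℝ => x + r i) '' Bad δ) ∧
      (∀ t, a ≤ g t ∧ g t ≤ a + ℓ) ∧
      ∀ t ∈ Set.Ico (0 : ℝ) 1, ∀ t' ∈ Set.Ico (0 : ℝ) 1, t ≤ t' → ∀ k : ℕ,
        ((⌊t' * (M : ℝ) ^ k⌋ : ℝ) - ⌊t * (M : ℝ) ^ k⌋ - 1) * (ℓ / (3 * M) ^ k) ≤ |g t - g t'| := by
  have hM0 : (1 : ℝ) ≤ M := by exact_mod_cast hM
  have hpos : ∀ k : ℕ, 0 < ℓ / (3 * (M : ℝ)) ^ k := fun k => by positivity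
  let s : ℕ → ℤ → ℤ := fun k n =>
    goodThird (r ⟨k % N, Nat.mod_lt _ hN⟩) (a + n * (ℓ / (3 * M) ^ k)) (ℓ / (3 * M) ^ k)
  have hs0 : ∀ k n, 0 ≤ s k n := fun k n => goodThird_nonneg _ _ _
  have hs2 : ∀ k n, s k n ≤ 2 := fun k n => goodThird_le_two _ _ _
  choose g hg using exists_mem_thirdsIndex_intervals hM hs0 hs2 a hℓ
  refine ⟨g, fun t => ?_, fun t => ?_, fun t ht t' ht' htt k => ?_⟩
  · obtain ⟨n, hn⟩ := exists_nat_gt ((3 * (M : ℝ)) ^ N / ℓ)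
    refine mem_iInter_image_bad hδ (Q := n + 1) (by positivity) fun i q hq p => ?_
    have hq1 : (n : ℝ) + 1 ≤ q := by exact_mod_cast hq
    have hn0 : (0 : ℝ) ≤ n := Nat.cast_nonneg n
    have hq0 : (0 : ℝ) < q := by linarith
    have hqZ : 0 < q := by exact_mod_cast hq0
    have hlarge : (3 * (M : ℝ)) ^ N < (q : ℝ) ^ 2 * ℓ := by
      rw [← div_lt_iff₀ hℓ]
      nlinarith
    obtain ⟨k, hk, hk1, hk2⟩ := exists_level (ε := 6 * δ) (by linarith) hMδ hℓ i.2 hlarge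
    have hi : (⟨k % N, Nat.mod_lt _ hN⟩ : Fin N) = i := Fin.ext hk
    obtain ⟨g1, g2⟩ := hg t (k + 1)
    have hstep : ℓ / (3 * (M : ℝ)) ^ k = 3 * M * (ℓ / (3 * M) ^ (k + 1)) := by
      rw [pow_succ]
      field_simp
    have hd0 : (0 : ℝ) ≤ baseDigit M t k := by exact_mod_cast baseDigit_nonneg M t k
    have hd1 : (baseDigit M t k : ℝ) + 1 ≤ M := by exact_mod_cast baseDigit_lt hM t k
    have key : ℓ / (3 * (M : ℝ)) ^ k / 6 ≤ |g t - (p / q + r i)| := by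
      refine goodThird_avoids (ρ := r i) (a := a + thirdsIndex M s t k * (ℓ / (3 * M) ^ k))
        (hpos k) ?_ ?_ ⟨p, q, hqZ, hk1, rfl⟩
      · refine le_trans ?_ g1
        have hsk : goodThird (r i) (a + thirdsIndex M s t k * (ℓ / (3 * M) ^ k))
            (ℓ / (3 * M) ^ k) = s k (thirdsIndex M s t k) := by simp only [s, hi]
        rw [hsk, hstep]
        simp only [thirdsIndex]
        push_cast
        have := mul_nonneg hd0 (hpos (k + 1)).le
        linarith
      · refine le_trans g2 ?_
        have hsk : goodThird (r i) (a + thirdsIndex M s t k * (ℓ / (3 * M) ^ k))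
            (ℓ / (3 * M) ^ k) = s k (thirdsIndex M s t k) := by simp only [s, hi]
        rw [hsk, hstep]
        simp only [thirdsIndex]
        push_cast
        have := mul_nonneg (sub_nonneg.2 hd1) (hpos (k + 1)).le
        linarith
    refine le_trans ?_ key
    rw [div_le_iff₀ (by positivity)]
    linarith
  · simpa [thirdsIndex] using hg t 0
  -- Intervals whose indices differ by `d` leave a gap of only `d - 1` lengths.
  · have h1 : ((⌊t' * (M : ℝ) ^ k⌋ : ℝ) - ⌊t * (M : ℝ) ^ k⌋) ≤
        thirdsIndex M s t' k - thirdsIndex M s t k := by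
      exact_mod_cast (thirdsIndex_sub_ge hM hs0 hs2 ht ht' htt k).1
    have h2 := mul_le_mul_of_nonneg_right h1 (hpos k).le
    rw [abs_sub_comm]
    refine le_trans ?_ (le_abs_self _)
    linarith [(hg t' k).1, (hg t k).2]

/-! ### Dimension from the Hölder inverse -/

/-- A set into which `[0, 1)` maps with Hölder inverse of exponent `e` has dimension at least
`e`. -/
theorem le_dimH_of_holder_inverse {S : Set ℝ} {g : ℝ → ℝ} (hgS : ∀ t, g t ∈ S) {C e : ℝ}
    (hC : 0 ≤ C) (he : 0 < e)
    (h : ∀ t ∈ Set.Ico (0 : ℝ) 1, ∀ t' ∈ Set.Ico (0 : ℝ) 1, |t - t'| ≤ C * |g t - g t'| ^ e) :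
    ENNReal.ofReal e ≤ dimH S := by
  have hinj : Set.InjOn g (Set.Ico 0 1) := by
    intro t ht t' ht' heq
    have := h t ht t' ht'
    rw [heq, sub_self, abs_zero, Real.zero_rpow he.ne', mul_zero] at this
    exact sub_eq_zero.1 (abs_eq_zero.1 (le_antisymm this (abs_nonneg _)))
  have hleft := hinj.leftInvOn_invFunOn
  have hhol : HolderOnWith C.toNNReal e.toNNReal (Function.invFunOn g (Set.Ico 0 1))
      (g '' Set.Ico 0 1) := by
    rintro _ ⟨t, ht, rfl⟩ _ ⟨t', ht', rfl⟩
    rw [hleft ht, hleft ht', edist_dist, edist_dist, Real.dist_eq, Real.dist_eq,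
      Real.coe_toNNReal e he.le, ENNReal.ofReal_rpow_of_nonneg (abs_nonneg _) he.le]
    change _ ≤ ENNReal.ofReal C * _
    rw [← ENNReal.ofReal_mul hC]
    exact ENNReal.ofReal_le_ofReal (h t ht t' ht')
  have hdim := hhol.dimH_image_le (Real.toNNReal_pos.2 he)
  rw [hleft.image_image, Real.dimH_of_nonempty_interior (by simp [interior_Ico])] at hdim
  have he' : (e.toNNReal : ENNReal) ≠ 0 := by simpa using he
  rw [ENNReal.le_div_iff_mul_le (Or.inl he') (Or.inl ENNReal.coe_ne_top),
    Module.finrank_self, Nat.cast_one, one_mul] at hdim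
  exact hdim.trans (dimH_mono (Set.image_subset_iff.2 fun t _ => hgS t))

/-- The comparison of base-`M` digits at all scales `(3 * M) ^ (-k)` gives a Hölder bound of
exponent `log M / log (3 * M)`. -/
theorem abs_sub_le_rpow_of_floor_le {M : ℕ} (hM : 2 ≤ M) {t t' D : ℝ} (hD : 0 ≤ D)
    (hD1 : D ≤ 1) (htt : t ≤ t')
    (h : ∀ k : ℕ, ((⌊t' * (M : ℝ) ^ k⌋ : ℝ) - ⌊t * (M : ℝ) ^ k⌋ - 1) * (1 / (3 * M) ^ k) ≤ D) :
    |t - t'| ≤ 3 * M * D ^ (Real.log M / Real.log (3 * M)) := by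
  have hM0 : (2 : ℝ) ≤ M := by exact_mod_cast hM
  have hlogM : 0 < Real.log M := Real.log_pos (by linarith)
  have hlog3M : 0 < Real.log (3 * M) := Real.log_pos (by linarith)
  -- The floors differ by at most `2`, hence the `3` in the constant.
  have hbound : ∀ k : ℕ, D ≤ 1 / (3 * (M : ℝ)) ^ k → (t' - t) * (M : ℝ) ^ k ≤ 3 := by
    intro k hk
    have h1 := (h k).trans hk
    have h2 : (⌊t' * (M : ℝ) ^ k⌋ : ℝ) - ⌊t * (M : ℝ) ^ k⌋ - 1 ≤ 1 := by
      have hp : (0 : ℝ) < 1 / (3 * M) ^ k := by positivity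
      nlinarith
    have h3 := Int.lt_floor_add_one (t' * (M : ℝ) ^ k)
    have h4 := Int.floor_le (t * (M : ℝ) ^ k)
    linarith
  rw [abs_sub_comm, abs_of_nonneg (sub_nonneg.2 htt)]
  rcases hD.eq_or_lt with h0 | h0
  · rw [← h0, Real.zero_rpow (by positivity), mul_zero]
    by_contra! hlt
    obtain ⟨n, hn⟩ := pow_unbounded_of_one_lt (3 / (t' - t)) (by linarith : (1 : ℝ) < M)
    rw [div_lt_iff₀ hlt] at hn
    have := hbound n (by rw [← h0]; positivity)
    linarith
  -- With `(3M)^k ≤ 1/D < (3M)^(k+1)`, overshooting by one level costs the factor `M` in the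
  -- constant.
  · obtain ⟨k, hk1, hk2⟩ := exists_nat_pow_near (one_le_one_div h0 hD1)
      (by linarith : 1 < 3 * (M : ℝ))
    have hk : D ≤ 1 / (3 * (M : ℝ)) ^ k := by
      rw [le_div_iff₀ (by positivity)]
      rwa [le_div_iff₀ h0, mul_comm] at hk1
    have h1 := hbound k hk
    have hpow : (3 * (M : ℝ)) ^ (Real.log M / Real.log (3 * M)) = M := by
      rw [Real.rpow_def_of_pos (by positivity), mul_div_cancel₀ _ hlog3M.ne',
        Real.exp_log (by linarith)]
    have h2 : (1 : ℝ) ≤ (M : ℝ) ^ (k + 1) * D ^ (Real.log M / Real.log (3 * M)) := by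
      have : (1 : ℝ) ≤ (3 * (M : ℝ)) ^ (k + 1) * D := by
        rw [div_lt_iff₀ h0] at hk2
        exact hk2.le
      have h3 := Real.one_le_rpow this (by positivity : 0 ≤ Real.log M / Real.log (3 * M))
      rwa [Real.mul_rpow (by positivity) hD, ← Real.rpow_natCast, ← Real.rpow_mul
        (by positivity), mul_comm ((k + 1 : ℕ) : ℝ), Real.rpow_mul (by positivity), hpow, Real.rpow_natCast] at h3
    have hMk : (0 : ℝ) < (M : ℝ) ^ k := by positivity
    refine le_of_mul_le_mul_right ?_ hMk
    rw [pow_succ] at h2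
    nlinarith

theorem mainTheorem6 (N : ℕ) (hN : 1 ≤ N) (r : Fin N → ℝ) (δ : ℝ) (hδ : 0 < δ)
    (hδ' : δ < (3 : ℝ) ^ (1 - (N : ℤ)) / 18) :
    Dense (⋂ i : Fin N, (fun x : ℝ => x + r i) '' Bad δ) ∧
    dimH (⋂ i : Fin N, (fun x : ℝ => x + r i) '' Bad δ) ≥
      ENNReal.ofReal
        ((N : ℝ) * Real.log (⌊(1 / (18 * δ * (3 : ℝ) ^ (N - 1))) ^ (1 / (N : ℝ))⌋ : ℝ) /
          Real.log (1 / (6 * δ))) := by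
  have hN0 : (N : ℝ) ≠ 0 := by positivity
  have h3 : (18 : ℝ) * δ * 3 ^ (N - 1) < 1 := by
    have he : (3 : ℝ) ^ (1 - (N : ℤ)) * 3 ^ (N - 1) = 1 := by
      rw [← zpow_natCast, ← zpow_add₀ (by norm_num), Nat.cast_sub hN]
      simp
    have hp : (0 : ℝ) < 3 ^ (N - 1) := by positivity
    nlinarith
  set y : ℝ := 1 / (18 * δ * (3 : ℝ) ^ (N - 1)) with hy
  have hy1 : 1 ≤ y := by
    rw [hy]
    exact one_le_one_div (by positivity) h3.le
  have hroot : 1 ≤ y ^ (1 / (N : ℝ)) := Real.one_le_rpow hy1 (by positivity)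
  obtain ⟨M, hMfl⟩ := Int.eq_ofNat_of_zero_le (Int.floor_nonneg.2 (zero_le_one.trans hroot))
  have hM : 1 ≤ M := by
    have : (1 : ℤ) ≤ ⌊y ^ (1 / (N : ℝ))⌋ := Int.le_floor.2 (by simpa using hroot)
    omega
  have hM0 : (1 : ℝ) ≤ M := by exact_mod_cast hM
  have hMy : (M : ℝ) ^ N ≤ y := by
    have h1 : (M : ℝ) ≤ y ^ (1 / (N : ℝ)) := by
      have := Int.floor_le (y ^ (1 / (N : ℝ)))
      rw [hMfl] at this
      exact_mod_cast this
    calc (M : ℝ) ^ N ≤ (y ^ (1 / (N : ℝ))) ^ N := by gcongr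
      _ = y := by
        rw [← Real.rpow_natCast, ← Real.rpow_mul (by linarith), one_div_mul_cancel hN0,
          Real.rpow_one]
  have hMδ : 6 * δ * (3 * (M : ℝ)) ^ N ≤ 1 := by
    rw [hy, le_div_iff₀ (by positivity)] at hMy
    have : (3 : ℝ) ^ N = 3 * 3 ^ (N - 1) := by
      rw [← pow_succ', Nat.sub_add_cancel hN]
    rw [mul_pow, this]
    linarith
  refine ⟨?_, ?_⟩
  · refine Metric.dense_iff.2 fun x ε hε => ?_
    obtain ⟨g, hg, hga, -⟩ := exists_param_iInter_bad hN r hδ hM hMδ x (half_pos hε)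
    refine ⟨g 0, ?_, hg 0⟩
    rw [Metric.mem_ball, Real.dist_eq, abs_lt]
    constructor <;> linarith [hga 0]
  · rw [hMfl, Int.cast_natCast, ge_iff_le]
    rcases hM.eq_or_lt with h1 | h1
    -- For `M = 1` the claimed bound is `0`.
    · simp [← h1]
    · have hM1 : (1 : ℝ) < M := by exact_mod_cast h1
      have hlogM : 0 < Real.log M := Real.log_pos hM1
      have hlog3M : 0 < Real.log (3 * M) := Real.log_pos (by linarith)
      obtain ⟨g, hg, hga, hgd⟩ := exists_param_iInter_bad hN r hδ hM hMδ 0 one_pos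
      have hdim := le_dimH_of_holder_inverse hg (C := 3 * M)
        (e := Real.log M / Real.log (3 * M)) (by positivity) (by positivity) (by
          intro t ht t' ht'
          have hD1 : ∀ u u', |g u - g u'| ≤ 1 := fun u u' =>
            abs_le.2 ⟨by linarith [hga u, hga u'], by linarith [hga u, hga u']⟩
          rcases le_total t t' with h | h
          · exact abs_sub_le_rpow_of_floor_le h1 (abs_nonneg _) (hD1 _ _) h (hgd t ht t' ht' h)
          · rw [abs_sub_comm t, abs_sub_comm (g t)]
            exact abs_sub_le_rpow_of_floor_le h1 (abs_nonneg _) (hD1 _ _) h (hgd t' ht' t ht h))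
      refine le_trans (ENNReal.ofReal_le_ofReal ?_) hdim
      have hlogδ : N * Real.log (3 * M) ≤ Real.log (1 / (6 * δ)) := by
        rw [← Real.log_pow]
        refine Real.log_le_log (by positivity) ?_
        rw [le_div_iff₀ (by positivity)]
        linarith
      have hNpos : (0 : ℝ) < N := by exact_mod_cast hN
      rw [div_le_div_iff₀ (lt_of_lt_of_le (by positivity) hlogδ) hlog3M]
      nlinarith [mul_le_mul_of_nonneg_left hlogδ hlogM.le]
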